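/- For a probability distribution $P$ of a real random variable $z$ write $m(P)=\mathbb E_P[z]$, and for $\kappa\ge 2$ let \[ \mathcal P_\kappa=\Big\{P:\ z\ge 0 \text{ almost surely},\ 0<\mathbb E_P[z]<\infty,\ \frac{\mathbb E_P[z^2]}{(\mathbb E_P[z])^2}\le\kappa\Big\}. \] Let $F_P(\nu)=m(P)e^{-\nu}+\nu$ for $\nu\in\mathbb R$; it is minimized at $\nu_*(P)=\log m(P)$. An algorithm does not know $P$ and accesses it through an oracle: at a query $\nu\in\mathbb R$ the oracle draws a fresh independent sample $z\sim P$ and returns the value $\Phi(\nu;z)=ze^{-\nu}+\nu$ and the gradient $\partial_\nu\Phi(\nu;z)=1-ze^{-\nu}$. An algorithm with $T$ oracle calls may be adaptive and randomized: each query is a measurable function of the previous answers and of an internal random seed independent of the samples, and the output $\widehat\nu\in\mathbb R$ is a measurable function of the seed and all $T$ answers. There is an absolute constant $c>0$ such that for every real $\kappa\ge2$, every integer $T\ge\kappa$ and every such algorithm with $T$ oracle calls, \[ \sup_{P\in\mathcal P_\kappa}\ \mathbb E_P\big[F_P(\widehat\nu)-F_P(\nu_*(P))\big]\ \ge\ c\,\frac{\kappa-1}{T},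 \] where the expectation, taken over the samples and the seed, is an element of $[0,\infty]$. -/

import Mathlib

open MeasureTheory

namespace SuboptLB

/-- The mean `m(P) = E_P[z]` of a probability distribution `P` of `z` on the real line. -/
noncomputable def mean (P : ProbabilityMeasure ℝ) : ℝ := ∫ z, z ∂(P : Measure ℝ)

/-- The class `𝒫_κ` of distributions of a variable `z ≥ 0` with `0 < E[z] < ∞` and
`E[z²] / (E[z])² ≤ κ`. The ratio bound includes that `E[z²]` is finite. -/
structure InClass (κ : ℝ) (P : ProbabilityMeasure ℝ) : Prop where
  nonneg : ∀ᵐ z ∂(P : Measure ℝ), 0 ≤ z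
  integrable : Integrable (fun z : ℝ => z) (P : Measure ℝ)
  mean_pos : 0 < mean P
  integrable_sq : Integrable (fun z : ℝ => z ^ 2) (P : Measure ℝ)
  ratio_le : (∫ z, z ^ 2 ∂(P : Measure ℝ)) / (mean P) ^ 2 ≤ κ

/-- The objective `F_P(ν) = m(P) e^{-ν} + ν`. -/
noncomputable def objective (P : ProbabilityMeasure ℝ) (ν : ℝ) : ℝ :=
  mean P * Real.exp (-ν) + ν

/-- The optimal point `ν_*(P) = log m(P)`. -/
noncomputable def nuStar (P : ProbabilityMeasure ℝ) : ℝ := Real.log (mean P)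

/-- `ν_*(P)` is the unique minimizer of `F_P`. -/
theorem objective_minimizer {P : ProbabilityMeasure ℝ} (hP : 0 < mean P) :
    (∀ ν, objective P (nuStar P) ≤ objective P ν) ∧
      ∀ ν, objective P ν = objective P (nuStar P) → ν = nuStar P := by
  have key : ∀ ν, objective P ν - objective P (nuStar P)
      = Real.exp (nuStar P - ν) - (nuStar P - ν) - 1 := by
    intro ν
    have h1 : mean P * Real.exp (-ν) = Real.exp (nuStar P - ν) := by
      rw [nuStar, sub_eq_add_neg, Real.exp_add, Real.exp_log hP]
    have h2 : mean P * Real.exp (-nuStar P) = 1 := by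
      rw [nuStar, Real.exp_neg, Real.exp_log hP, mul_inv_cancel₀ hP.ne']
    unfold objective
    rw [h1, h2]
    ring
  refine ⟨fun ν => ?_, fun ν h => ?_⟩
  · have := Real.add_one_le_exp (nuStar P - ν)
    linarith [key ν]
  · by_contra hne
    have := Real.add_one_lt_exp (sub_ne_zero.mpr (Ne.symm hne))
    linarith [key ν]

/-- The answer of the oracle to the query `ν` when the fresh sample is `z`: the pair of the value
`Φ(ν; z) = z e^{-ν} + ν` and the gradient `g(ν; z) = ∂Φ/∂ν = 1 - z e^{-ν}`. -/
noncomputable def oracle (ν z : ℝ) : ℝ × ℝ :=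
  (z * Real.exp (-ν) + ν, 1 - z * Real.exp (-ν))

theorem oracle_snd (ν z : ℝ) : (oracle ν z).2 = deriv (fun x => (oracle x z).1) ν := by
  have h : HasDerivAt (fun x : ℝ => z * Real.exp (-x) + x)
      (z * (Real.exp (-ν) * (-1)) + 1) ν :=
    (((hasDerivAt_id ν).neg.exp).const_mul z).add (hasDerivAt_id ν)
  simp only [oracle]
  rw [h.deriv]
  ring

/-- An adaptive, possibly randomized algorithm that makes `T` oracle calls. Its internal
randomness is a seed in `Ω`, drawn independently of the samples. The query number `t` (counted
from `0`) is a measurable function of the seed and the `t` answers received so far; the output is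
a measurable function of the seed and all `T` answers. Only the queries with `t < T` are made. -/
structure Algorithm (Ω : Type*) [MeasurableSpace Ω] (T : ℕ) where
  seedLaw : ProbabilityMeasure Ω
  query : (t : ℕ) → Ω × (Fin t → ℝ × ℝ) → ℝ
  measurable_query : ∀ t, Measurable (query t)
  output : Ω × (Fin T → ℝ × ℝ) → ℝ
  measurable_output : Measurable output

namespace Algorithm

variable {Ω : Type*} [MeasurableSpace Ω] {T : ℕ}

/-- The first `t` oracle answers, when the seed is `ω` and the oracle uses the sample `z i` in its
answer to query number `i`. -/
noncomputable def answers (A : Algorithm Ω T) (ω : Ω) :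
    (t : ℕ) → (Fin t → ℝ) → (Fin t → ℝ × ℝ)
  | 0, _ => Fin.elim0
  | t + 1, z =>
      let past : Fin t → ℝ × ℝ := answers A ω t (fun i => z i.castSucc)
      Fin.snoc (α := fun _ => ℝ × ℝ) past (oracle (A.query t (ω, past)) (z (Fin.last t)))

/-- The output `ν̂` for the seed `ω` and the samples `z`. -/
noncomputable def estimate (A : Algorithm Ω T) (ω : Ω) (z : Fin T → ℝ) : ℝ :=
  A.output (ω, A.answers ω T z)

/-- The expected suboptimality `E_P[F_P(ν̂) - F_P(ν_*(P))]`, over the seed and `T` independent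
samples from `P`. It is a number in `[0, ∞]`: for `P` with positive mean the integrand is
nonnegative, so `ENNReal.ofReal` does not change it. -/
noncomputable def expectedSubopt (A : Algorithm Ω T) (P : ProbabilityMeasure ℝ) : ENNReal :=
  ∫⁻ x : Ω × (Fin T → ℝ),
    ENNReal.ofReal (objective P (A.estimate x.1 x.2) - objective P (nuStar P))
    ∂((A.seedLaw : Measure Ω).prod (Measure.pi fun _ : Fin T => (P : Measure ℝ)))

end Algorithm

end SuboptLB

namespace SuboptLB

/-! ### Measurability of the output. -/

namespace Algorithm

variable {Ω : Type*} [MeasurableSpace Ω] {T : ℕ}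

/-! Le Cam's two-point method with Bernoulli laws of means `1 / κ` and `(1 + ε) / κ`, `ε² = κ /
(4T)`. The suboptimalities under the two laws sum to at least `ε² / (2 + ε)²` at every point
(`le_add_subopt`), while the χ² divergence per sample is `ε² / (κ - 1) ≤ 1 / (2T)`, so `T` samples
cannot tell the laws apart (`two_point_le_sum`). Adaptivity gives no advantage: for a fixed seed the
output is a function of the `T` samples alone. -/

theorem measurable_oracle : Measurable fun x : ℝ × ℝ => oracle x.1 x.2 := by
  unfold oracle
  fun_prop

theorem measurable_answers (A : Algorithm Ω T) (t : ℕ) :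
    Measurable fun x : Ω × (Fin t → ℝ) => A.answers x.1 t x.2 := by
  induction t with
  | zero => exact measurable_pi_iff.2 fun i => i.elim0
  | succ t ih =>
    have hpast : Measurable fun x : Ω × (Fin (t + 1) → ℝ) =>
        A.answers x.1 t (fun i => x.2 i.castSucc) :=
      ih.comp (measurable_fst.prodMk (measurable_pi_iff.2 fun i =>
        (measurable_pi_apply i.castSucc).comp measurable_snd))
    refine measurable_pi_iff.2 fun i => ?_
    refine Fin.lastCases ?_ (fun i => ?_) i
    · simp only [answers, Fin.snoc_last]
      exact measurable_oracle.comp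
        (((A.measurable_query t).comp (measurable_fst.prodMk hpast)).prodMk
          ((measurable_pi_apply (Fin.last t)).comp measurable_snd))
    · simp only [answers, Fin.snoc_castSucc]
      exact (measurable_pi_apply i).comp hpast

theorem measurable_estimate (A : Algorithm Ω T) :
    Measurable fun x : Ω × (Fin T → ℝ) => A.estimate x.1 x.2 :=
  A.measurable_output.comp (measurable_fst.prodMk (A.measurable_answers T))

end Algorithm

theorem measurable_objective (P : ProbabilityMeasure ℝ) : Measurable (objective P) := by
  unfold objective
  fun_prop

/-! ### Separation and indistinguishability. -/

/-- No point is nearly optimal for two distributions with different means. -/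
theorem le_add_subopt {P Q : ProbabilityMeasure ℝ} (hP : 0 < mean P) (hQ : 0 < mean Q) (ν : ℝ) :
    (mean Q - mean P) ^ 2 / (mean P + mean Q) ^ 2 ≤
      (objective P ν - objective P (nuStar P)) + (objective Q ν - objective Q (nuStar Q)) := by
  have hopt : ∀ {R : ProbabilityMeasure ℝ}, 0 < mean R →
      objective R (nuStar R) = 1 + Real.log (mean R) := fun {R} hR => by
    rw [objective, nuStar, Real.exp_neg, Real.exp_log hR, mul_inv_cancel₀ hR.ne']
  rw [hopt hP, hopt hQ]
  unfold objective
  generalize mean P = a at *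
  generalize mean Q = b at *
  -- The sum of the objectives is twice the objective with mean `(a + b) / 2`; bounding it by its
  -- minimum leaves `-log (4ab / (a + b)²)`, and `log x ≤ x - 1` finishes.
  have h1 := Real.add_one_le_exp (Real.log ((a + b) / 2) - ν)
  rw [sub_eq_add_neg, Real.exp_add, Real.exp_log (by positivity)] at h1
  have h2 := Real.log_le_sub_one_of_pos (x := 4 * a * b / (a + b) ^ 2) (by positivity)
  have h3 : Real.log (4 * a * b / (a + b) ^ 2) =
      Real.log a + Real.log b - 2 * Real.log ((a + b) / 2) := by
    have : 4 * a * b / (a + b) ^ 2 = a * b / ((a + b) / 2) ^ 2 := by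
      field_simp
      ring
    rw [this, Real.log_div (by positivity) (by positivity), Real.log_mul hP.ne' hQ.ne',
      Real.log_pow]
    norm_num
  have h4 : (b - a) ^ 2 / (a + b) ^ 2 = 1 - 4 * a * b / (a + b) ^ 2 := by
    field_simp
    ring
  linarith

/-- Le Cam's two-point bound for product weights, with the `χ²` divergence as the measure of
closeness. -/
theorem two_point_le_sum {ι : Type*} [Fintype ι] (T : ℕ) {u v : ι → ℝ} (hu : ∀ i, 0 < u i)
    (hv : ∀ i, 0 ≤ v i) (hv1 : ∑ i, v i = 1) {f g : (Fin T → ι) → ℝ} (hf : ∀ b, 0 ≤ f b)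
    (hg : ∀ b, 0 ≤ g b) {s : ℝ} (hs : 0 ≤ s) (hfg : ∀ b, s ≤ f b + g b) :
    s * (1 - (∑ i, v i ^ 2 / u i) ^ T / 4) ≤
      ∑ b, (∏ i, u (b i)) * f b + ∑ b, (∏ i, v (b i)) * g b := by
  classical
  have hsum : ∀ h : ι → ℝ, (∑ i, h i) ^ T = ∑ b : Fin T → ι, ∏ i, h (b i) := fun h => by
    simpa using (Finset.prod_univ_sum (fun _ : Fin T => (Finset.univ : Finset ι)) fun _ j => h j)
  have h1 : (1 : ℝ) = ∑ b : Fin T → ι, ∏ i, v (b i) := by rw [← hsum, hv1, one_pow]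
  rw [hsum, ← Finset.sum_add_distrib]
  nth_rewrite 1 [h1]
  rw [Finset.sum_div, ← Finset.sum_sub_distrib, Finset.mul_sum]
  refine Finset.sum_le_sum fun b _ => ?_
  rw [Finset.prod_div_distrib, Finset.prod_pow]
  have hU : 0 < ∏ i, u (b i) := Finset.prod_pos fun i _ => hu _
  have hV : 0 ≤ ∏ i, v (b i) := Finset.prod_nonneg fun i _ => hv _
  generalize ∏ i, u (b i) = U at *
  generalize ∏ i, v (b i) = V at *
  -- Unlike `min U V`, this lower bound sums in closed form, since `V² / U` factorizes over the
  -- samples.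
  have hmin : V - V ^ 2 / U / 4 ≤ min U V := by
    refine le_min ?_ (sub_le_self _ (by positivity))
    have : U - (V - V ^ 2 / U / 4) = (2 * U - V) ^ 2 / (4 * U) := by
      field_simp
      ring
    have : 0 ≤ (2 * U - V) ^ 2 / (4 * U) := by positivity
    linarith
  calc s * (V - V ^ 2 / U / 4) ≤ s * min U V := mul_le_mul_of_nonneg_left hmin hs
    _ ≤ (f b + g b) * min U V := mul_le_mul_of_nonneg_right (hfg b) (le_min hU.le hV)
    _ = min U V * f b + min U V * g b := by ring
    _ ≤ U * f b + V * g b := add_le_add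
      (mul_le_mul_of_nonneg_right (min_le_left _ _) (hf b))
      (mul_le_mul_of_nonneg_right (min_le_right _ _) (hg b))

/-! ### Bernoulli distributions. -/

/-- The weights of the Bernoulli distribution with success probability `p`. -/
def weight (p : ℝ) (b : Bool) : ℝ := if b then p else 1 - p

/-- The Bernoulli distribution on `Bool` with success probability `p`. -/
noncomputable def boolLaw (p : ℝ) : Measure Bool :=
  ∑ b : Bool, ENNReal.ofReal (weight p b) • Measure.dirac b

theorem boolLaw_singleton (p : ℝ) (b : Bool) : boolLaw p {b} = ENNReal.ofReal (weight p b) := by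
  cases b <;> simp [boolLaw]

theorem isProbabilityMeasure_boolLaw {p : ℝ} (h0 : 0 ≤ p) (h1 : p ≤ 1) :
    IsProbabilityMeasure (boolLaw p) := by
  constructor
  simp only [boolLaw, weight, Fintype.sum_bool]
  simp [← ENNReal.ofReal_add h0 (sub_nonneg.2 h1)]

/-- The real number `0` or `1` that encodes a truth value. -/
def boolVal (b : Bool) : ℝ := if b then 1 else 0

/-- The Bernoulli distribution on the real line. -/
noncomputable def bernoulliReal (p : ℝ) (h0 : 0 ≤ p) (h1 : p ≤ 1) : ProbabilityMeasure ℝ :=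
  ⟨(boolLaw p).map boolVal,
    have := isProbabilityMeasure_boolLaw h0 h1
    Measure.isProbabilityMeasure_map (measurable_of_countable boolVal).aemeasurable⟩

section Bernoulli

variable {p : ℝ} (h0 : 0 ≤ p) (h1 : p ≤ 1)

theorem integral_bernoulliReal {f : ℝ → ℝ} (hf : Measurable f) :
    ∫ z, f z ∂(bernoulliReal p h0 h1 : Measure ℝ) = (1 - p) * f 0 + p * f 1 := by
  have := isProbabilityMeasure_boolLaw h0 h1
  change ∫ z, f z ∂((boolLaw p).map boolVal) = _
  rw [integral_map (measurable_of_countable boolVal).aemeasurable hf.aestronglyMeasurable,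
    integral_fintype Integrable.of_finite]
  simp [Measure.real, boolLaw_singleton, weight, boolVal, h0, h1, add_comm]

theorem integrable_bernoulliReal {f : ℝ → ℝ} (hf : Measurable f) :
    Integrable f (bernoulliReal p h0 h1 : Measure ℝ) := by
  have := isProbabilityMeasure_boolLaw h0 h1
  change Integrable f ((boolLaw p).map boolVal)
  rw [integrable_map_measure hf.aestronglyMeasurable
    (measurable_of_countable boolVal).aemeasurable]
  exact Integrable.of_finite

theorem mean_bernoulliReal : mean (bernoulliReal p h0 h1) = p := by
  rw [mean, integral_bernoulliReal h0 h1 measurable_id']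
  simp

/-- Since `z² = z` on `{0, 1}`, the moment ratio is exactly `1 / p`. -/
theorem inClass_bernoulliReal {κ : ℝ} (hp : 0 < p) (hκ : 1 / p ≤ κ) :
    InClass κ (bernoulliReal p h0 h1) where
  nonneg := by
    change ∀ᵐ z ∂((boolLaw p).map boolVal), 0 ≤ z
    rw [ae_map_iff (measurable_of_countable boolVal).aemeasurable measurableSet_Ici]
    exact .of_forall fun b => by cases b <;> simp [boolVal]
  integrable := integrable_bernoulliReal h0 h1 measurable_id'
  mean_pos := by rwa [mean_bernoulliReal]
  integrable_sq := integrable_bernoulliReal h0 h1 (by fun_prop)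
  ratio_le := by
    rw [integral_bernoulliReal h0 h1 (by fun_prop), mean_bernoulliReal]
    convert hκ using 1
    field_simp
    ring

/-- Turns the expectation over samples into the finite sum to which `two_point_le_sum` applies. -/
theorem lintegral_pi_bernoulliReal {T : ℕ} {f : (Fin T → ℝ) → ℝ} (hf : Measurable f)
    (hf0 : ∀ z, 0 ≤ f z) :
    ∫⁻ z, ENNReal.ofReal (f z) ∂(Measure.pi fun _ : Fin T => (bernoulliReal p h0 h1 : Measure ℝ)) =
      ENNReal.ofReal (∑ b : Fin T → Bool, (∏ i, weight p (b i)) * f fun i => boolVal (b i)) := by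
  have := isProbabilityMeasure_boolLaw h0 h1
  have hw : ∀ b, 0 ≤ weight p b := fun b => by cases b <;> simp [weight, h0, h1]
  have hm : ∀ _ : Fin T, AEMeasurable boolVal (boolLaw p) :=
    fun _ => (measurable_of_countable boolVal).aemeasurable
  have : ∀ _ : Fin T, SigmaFinite ((boolLaw p).map boolVal) := fun i =>
    have := Measure.isProbabilityMeasure_map (hm i)
    inferInstance
  change ∫⁻ z, ENNReal.ofReal (f z) ∂(Measure.pi fun _ : Fin T => (boolLaw p).map boolVal) = _
  rw [← Measure.pi_map_pi hm, lintegral_map hf.ennreal_ofReal (measurable_of_countable _),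
    lintegral_fintype, ENNReal.ofReal_sum_of_nonneg
      fun b _ => mul_nonneg (Finset.prod_nonneg fun i _ => hw _) (hf0 _)]
  refine Finset.sum_congr rfl fun b _ => ?_
  rw [Measure.pi_singleton, ENNReal.ofReal_mul (Finset.prod_nonneg fun i _ => hw _),
    ENNReal.ofReal_prod_of_nonneg fun i _ => hw _, mul_comm]
  simp_rw [boolLaw_singleton]

end Bernoulli

/-! ### The lower bound for algorithms. -/

/-- The two-point bound for an algorithm and two Bernoulli distributions. -/
theorem two_point_le_expectedSubopt {Ω : Type*} [MeasurableSpace Ω] {T : ℕ} (A : Algorithm Ω T)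
    {p q : ℝ} (hp : 0 < p) (hp1 : p < 1) (hq : 0 < q) (hq1 : q ≤ 1) :
    ENNReal.ofReal ((q - p) ^ 2 / (p + q) ^ 2 *
        (1 - (1 + (q - p) ^ 2 / (p * (1 - p))) ^ T / 4)) ≤
      A.expectedSubopt (bernoulliReal p hp.le hp1.le) +
        A.expectedSubopt (bernoulliReal q hq.le hq1) := by
  have hnonneg : ∀ {R : ProbabilityMeasure ℝ}, 0 < mean R → ∀ ν,
      0 ≤ objective R ν - objective R (nuStar R) :=
    fun hR ν => sub_nonneg.2 ((objective_minimizer hR).1 ν)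
  set P := bernoulliReal p hp.le hp1.le with hP
  set Q := bernoulliReal q hq.le hq1 with hQ
  have mP : mean P = p := mean_bernoulliReal _ _
  have mQ : mean Q = q := mean_bernoulliReal _ _
  have hPpos : 0 < mean P := mP ▸ hp
  have hQpos : 0 < mean Q := mQ ▸ hq
  have hmeas : ∀ R : ProbabilityMeasure ℝ, Measurable fun x : Ω × (Fin T → ℝ) =>
      objective R (A.estimate x.1 x.2) - objective R (nuStar R) := fun R =>
    ((measurable_objective R).comp A.measurable_estimate).sub_const _
  unfold Algorithm.expectedSubopt
  rw [lintegral_prod _ (hmeas P).ennreal_ofReal.aemeasurable,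
    lintegral_prod _ (hmeas Q).ennreal_ofReal.aemeasurable,
    ← lintegral_add_left (hmeas P).ennreal_ofReal.lintegral_prod_right']
  -- The bound does not depend on the seed, so it suffices to prove it for each fixed seed.
  refine le_trans ?_ (lintegral_mono (f := fun _ => ENNReal.ofReal ((q - p) ^ 2 / (p + q) ^ 2 *
        (1 - (1 + (q - p) ^ 2 / (p * (1 - p))) ^ T / 4))) fun ω => ?_)
  · simp
  have hω : ∀ R : ProbabilityMeasure ℝ, Measurable fun z : Fin T → ℝ =>
      objective R (A.estimate ω z) - objective R (nuStar R) :=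
    fun R => (hmeas R).comp measurable_prodMk_left
  dsimp only
  rw [lintegral_pi_bernoulliReal hp.le hp1.le (hω P) fun _ => hnonneg hPpos _,
    lintegral_pi_bernoulliReal hq.le hq1 (hω Q) fun _ => hnonneg hQpos _, ← ENNReal.ofReal_add]
  · refine ENNReal.ofReal_le_ofReal ?_
    have hχ : 1 + (q - p) ^ 2 / (p * (1 - p)) = ∑ b, weight q b ^ 2 / weight p b := by
      have : 1 - p ≠ 0 := (sub_pos.2 hp1).ne'
      simp only [weight, Fintype.sum_bool]
      simp only [if_true, Bool.false_eq_true, if_false]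
      field_simp
      ring
    rw [hχ]
    refine two_point_le_sum T (fun b => ?_) (fun b => ?_) ?_ (fun _ => hnonneg hPpos _)
      (fun _ => hnonneg hQpos _) (by positivity) fun b => ?_
    · cases b <;> simp [weight, hp, hp1]
    · cases b <;> simp [weight, hq.le, hq1]
    · simp [weight]
    · have := le_add_subopt hPpos hQpos (A.estimate ω fun i => boolVal (b i))
      rwa [mP, mQ] at this
  · refine Finset.sum_nonneg fun b _ => mul_nonneg (Finset.prod_nonneg fun i _ => ?_)
      (hnonneg hPpos _)
    cases b i <;> simp [weight, hp.le, hp1.le]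
  · refine Finset.sum_nonneg fun b _ => mul_nonneg (Finset.prod_nonneg fun i _ => ?_)
      (hnonneg hQpos _)
    cases b i <;> simp [weight, hq.le, hq1]

/-- The numerical value of the two-point bound for the success probabilities `1 / κ` and
`(1 + ε) / κ`, where `ε² = κ / (4 T)`. -/
theorem le_two_point_bound {κ ε : ℝ} (hκ : 2 ≤ κ) {T : ℕ} (hT : κ ≤ T) (hε : 0 ≤ ε)
    (hε2 : ε ^ 2 = κ / (4 * T)) :
    κ / (72 * T) ≤ ((1 + ε) / κ - 1 / κ) ^ 2 / (1 / κ + (1 + ε) / κ) ^ 2 *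
      (1 - (1 + ((1 + ε) / κ - 1 / κ) ^ 2 / (1 / κ * (1 - 1 / κ))) ^ T / 4) := by
  have hκ0 : 0 < κ := by linarith
  have hT0 : (0 : ℝ) < T := by linarith
  have hκ1 : 0 < κ - 1 := by linarith
  have hε1 : ε ≤ 1 := by
    have : ε ^ 2 ≤ 1 := by
      rw [hε2, div_le_one (by positivity)]
      linarith
    exact (sq_le_one_iff₀ hε).1 this
  have hsep : ((1 + ε) / κ - 1 / κ) ^ 2 / (1 / κ + (1 + ε) / κ) ^ 2 = ε ^ 2 / (2 + ε) ^ 2 := by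
    field_simp
    ring
  have hχ : ((1 + ε) / κ - 1 / κ) ^ 2 / (1 / κ * (1 - 1 / κ)) = ε ^ 2 / (κ - 1) := by
    field_simp
    ring
  have hpow : (1 + ε ^ 2 / (κ - 1)) ^ T ≤ 2 := by
    -- This is `κ / (κ - 1) ≤ 2`, which is where `κ ≥ 2` enters.
    have h1 : ε ^ 2 / (κ - 1) ≤ 1 / (2 * T) := by
      rw [hε2, div_div, div_le_div_iff₀ (by positivity) (by positivity)]
      nlinarith
    calc (1 + ε ^ 2 / (κ - 1)) ^ T ≤ Real.exp (1 / (2 * T)) ^ T := by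
          refine pow_le_pow_left₀ (by positivity) ?_ T
          linarith [Real.add_one_le_exp (1 / (2 * (T : ℝ)))]
      _ = Real.exp (1 / 2) := by
          rw [← Real.exp_nat_mul]
          congr 1
          field_simp
      _ ≤ 2 := by
          rw [← Real.le_log_iff_exp_le two_pos]
          linarith [Real.log_two_gt_d9]
  rw [hsep, hχ]
  calc κ / (72 * T) = ε ^ 2 / 9 * (1 / 2) := by
        rw [hε2]
        field_simp
        norm_num
    _ ≤ ε ^ 2 / (2 + ε) ^ 2 * (1 - (1 + ε ^ 2 / (κ - 1)) ^ T / 4) := by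
        -- `ε ≤ 1` gives `(2 + ε)² ≤ 9`, and `hpow` makes the last factor at least `1 / 2`.
        refine mul_le_mul ?_ (by linarith) (by norm_num) (by positivity)
        exact div_le_div_of_nonneg_left (by positivity) (by positivity) (by nlinarith)

end SuboptLB

theorem mainTheorem3 :
    ∃ c : ℝ, 0 < c ∧
      ∀ (κ : ℝ), 2 ≤ κ →
      ∀ (T : ℕ), κ ≤ (T : ℝ) →
      ∀ (Ω : Type*) [MeasurableSpace Ω] (A : SuboptLB.Algorithm Ω T),
        ENNReal.ofReal (c * (κ - 1) / (T : ℝ)) ≤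
          ⨆ (P : MeasureTheory.ProbabilityMeasure ℝ) (_ : SuboptLB.InClass κ P),
            A.expectedSubopt P := by
  -- `144 = 2 · 72`: the supremum is at least half the sum of the two risks, which is at least `κ /
  -- (72T)`.
  refine ⟨1 / 144, by norm_num, fun κ hκ T hT Ω _ A => ?_⟩
  have hκ0 : 0 < κ := by linarith
  have hT0 : (0 : ℝ) < T := by linarith
  set ε : ℝ := √(κ / (4 * T)) with hεdef
  have hε : 0 ≤ ε := Real.sqrt_nonneg _
  have hε2 : ε ^ 2 = κ / (4 * T) := Real.sq_sqrt (by positivity)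
  have hε1 : ε ≤ 1 := by
    refine Real.sqrt_le_one.2 ?_
    rw [div_le_one (by positivity)]
    linarith
  have hp : 0 < 1 / κ := by positivity
  have hp1 : 1 / κ < 1 := by
    rw [div_lt_one hκ0]
    linarith
  have hq : 0 < (1 + ε) / κ := by positivity
  have hq1 : (1 + ε) / κ ≤ 1 := by
    rw [div_le_one hκ0]
    linarith
  have hbound := (ENNReal.ofReal_le_ofReal (SuboptLB.le_two_point_bound hκ hT hε hε2)).trans
    (SuboptLB.two_point_le_expectedSubopt A hp hp1 hq hq1)
  have hPc := SuboptLB.inClass_bernoulliReal hp.le hp1.le hp (κ := κ) (by simp)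
  have hQc := SuboptLB.inClass_bernoulliReal hq.le hq1 hq (κ := κ) (by
    rw [one_div_div]
    exact div_le_self hκ0.le (by linarith))
  set S := ⨆ (P : ProbabilityMeasure ℝ) (_ : SuboptLB.InClass κ P), A.expectedSubopt P
  have h2 : ENNReal.ofReal (κ / (72 * T)) ≤ 2 * S := by
    rw [two_mul]
    exact hbound.trans (add_le_add (le_iSup₂_of_le _ hPc le_rfl) (le_iSup₂_of_le _ hQc le_rfl))
  have h3 : 2 * ENNReal.ofReal (1 / 144 * (κ - 1) / T) ≤ 2 * S := by
    refine le_trans ?_ h2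
    rw [← ENNReal.ofReal_ofNat 2, ← ENNReal.ofReal_mul (by norm_num)]
    refine ENNReal.ofReal_le_ofReal ?_
    rw [← mul_div_assoc, div_le_div_iff₀ hT0 (by positivity)]
    nlinarith
  exact (ENNReal.mul_le_mul_iff_right two_ne_zero ENNReal.ofNat_ne_top).1 h3
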